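/- Theorem (Binary classification margin bound for GTQKs). \label{Theorem:Generalization-pTIQK} Let $\mathcal X$ be a measurable space, let $\rho(x)=U(x)\rho_0U(x)^\dagger$ be a measurable embedding of $x\in\mathcal X$ into $n$-qubit states ($\rho_0$ a density operator, $U(x)$ unitary), and let $A_1,\dots,A_{4^n}$ be Hermitian operators on $n$ qubits with $\operatorname{tr}(A_iA_j)=\delta_{ij}$. The Lego kernels are $k_i(x,x')=\operatorname{tr}(\rho(x)A_i)\operatorname{tr}(\rho(x')A_i)$, and the generalized trace-induced quantum kernel (GTQK) with weights $w_i\ge 0$, $\sum_i w_i^2=1$, is $k=\sum_{i=1}^{4^n}w_i\,2^nk_i$. Fix a set $I\subseteq\{1,\dots,4^n\}$ of size $p$, and let $\mathcal H_{\rm G}$ be the hypothesis class of the GTQKs whose $p$ non-zero weights are those with index in $I$, that is, the union of the unit balls of their RKHSs: $$\mathcal H_{\rm G}=\Big\{\sum_{k=1}^{4^n}\tilde\alpha_k\sqrt{2^nw_k}\,\operatorname{tr}(\rho(\cdot)A_k)\;:\;\sum_k\tilde\alpha_k^2\le 1,\ \sum_kw_k^2=1,\ w_k>0\text{ for }k\in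 I,\ w_k=0\text{ for }k\notin I\Big\}.$$ Let $R\in\mathbb R$ be such that the Lego kernels, normalized as they enter the GTQK, satisfy $2^nk_i(x,x)\le R^2$ for all $i\in I$ and $x\in\mathcal X$. Let $\mathcal D$ be a probability distribution on pairs $(x,y)$ with $x\in\mathcal X$ and $y\in\{-1,1\}$. For $\mathcal C>0$ let $\Phi_{\mathcal C}(z)=1$ for $z\le 0$, $\Phi_{\mathcal C}(z)=1-z/\mathcal C$ for $0\le z\le\mathcal C$ and $\Phi_{\mathcal C}(z)=0$ for $z\ge\mathcal C$. For $f\in\mathcal H_{\rm G}$ and a sample $S=\{(x_i,y_i)\}_{i=1}^N$, $N\ge 1$, let $$\mathcal L_f^{(\mathcal C)}=\mathbb E_{(x,y)\sim\mathcal D}\,\Phi_{\mathcal C}(yf(x)),\qquad \mathcal L_f^{(\mathcal C)}(S)=\frac1N\sum_{i=1}^N\Phi_{\mathcal C}(y_if(x_i)).$$ Then for every $\delta\in(0,1]$, with probability at least $1-\delta$ over the i.i.d. sample $S\sim\mathcal D^N$, all $f\in\mathcal H_{\rm G}$ satisfy $$\mathcal L_f^{(\mathcal C)}\le\mathcal L_f^{(\mathcal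 C)}(S)+\frac{2p^{1/4}}{\mathcal C}\sqrt{\frac{2\eta_0R^2}{N}}+3\sqrt{\frac{\log\frac2\delta}{2N}},\qquad \eta_0=\frac{23}{22}.$$ Hence the generalization gap scales as $O(p^{1/4})$: there is a constant $K$ depending only on $\mathcal C$, $R$ and $\delta$ (not on $p$, $N$, $n$, the embedding, the operators $A_i$, $I$ or $\mathcal D$) such that on the same event $\mathcal L_f^{(\mathcal C)}-\mathcal L_f^{(\mathcal C)}(S)\le Kp^{1/4}/\sqrt N$ for all $f\in\mathcal H_{\rm G}$. -/

import Mathlib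

open MeasureTheory
open scoped ComplexOrder

universe u

noncomputable section

/-- Operators on the Hilbert space of `n` qubits, written in the computational basis, which is
indexed by the bit strings of length `n`. -/
abbrev QubitOp (n : ℕ) : Type := Matrix (Fin n → Fin 2) (Fin n → Fin 2) ℂ

/-- A density operator (quantum state) on `n` qubits. -/
def IsDensityOp {n : ℕ} (ρ : QubitOp n) : Prop :=
  ρ.PosSemidef ∧ ρ.trace = 1

/-- The encoded state `ρ(x) = U(x) ρ₀ U(x)†`. -/
def encodedState {X : Type*} {n : ℕ} (U : X → Matrix.unitaryGroup (Fin n → Fin 2) ℂ)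
    (ρ₀ : QubitOp n) (x : X) : QubitOp n :=
  (U x : QubitOp n) * ρ₀ * ((U x : QubitOp n)).conjTranspose

/-- An orthonormal Hermitian operator basis: `4 ^ n` Hermitian operators on `n` qubits with
`tr (A i * A j) = δ i j`.  (The space of Hermitian operators has real dimension `4 ^ n`, so
such a family is a basis of it.) -/
def IsOrthonormalHermitianBasis {n : ℕ} (A : Fin (4 ^ n) → QubitOp n) : Prop :=
  (∀ i, (A i).IsHermitian) ∧ ∀ i j, (A i * A j).trace = if i = j then 1 else 0

/-- The expectation value `tr (ρ A)`, a real number for Hermitian `ρ` and `A`. -/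
def expVal {n : ℕ} (ρ A : QubitOp n) : ℝ := ((ρ * A).trace).re

/-- The Lego kernel `tr (ρ(x) A) * tr (ρ(x') A)` of the operator `A`. -/
def legoKernel {X : Type*} {n : ℕ} (ρ : X → QubitOp n) (A : QubitOp n) (x x' : X) : ℝ :=
  expVal (ρ x) A * expVal (ρ x') A

/-- Weights of a GTQK whose non-zero weights are exactly those with index in `I`:
they are positive on `I`, vanish off `I`, and have sum of squares `1`. -/
def IsGTQKWeight {n : ℕ} (I : Finset (Fin (4 ^ n))) (w : Fin (4 ^ n) → ℝ) : Prop :=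
  (∀ i ∈ I, 0 < w i) ∧ (∀ i, i ∉ I → w i = 0) ∧ ∑ i, w i ^ 2 = 1

/-- The hypothesis class of all GTQKs `∑ i, 2 ^ n * w i * legoKernel ρ (A i) x x'` whose non-zero
weights are exactly those with index in `I`: the union, over all such weights `w`, of the
unit balls `∑ k, α k ^ 2 ≤ 1` of the associated RKHSs. -/
def gtqkClass {X : Type*} {n : ℕ} (ρ : X → QubitOp n) (A : Fin (4 ^ n) → QubitOp n)
    (I : Finset (Fin (4 ^ n))) : Set (X → ℝ) :=
  {f | ∃ w α : Fin (4 ^ n) → ℝ, IsGTQKWeight I w ∧ ∑ k, α k ^ 2 ≤ 1 ∧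
    f = fun x => ∑ k, α k * Real.sqrt (2 ^ n * w k) * expVal (ρ x) (A k)}

/-- The `C`-margin loss function. -/
def marginLoss (C z : ℝ) : ℝ :=
  if z ≤ 0 then 1 else if z ≤ C then 1 - z / C else 0

/-- The empirical `C`-margin loss of `f` on the labelled sample `S`. -/
def empiricalMarginLoss {X : Type*} {N : ℕ} (C : ℝ) (f : X → ℝ) (S : Fin N → X × ℝ) : ℝ :=
  (1 / (N : ℝ)) * ∑ i, marginLoss C ((S i).2 * f (S i).1)

/-- The true `C`-margin loss of `f` under the data distribution `D`. -/
def trueMarginLoss {X : Type*} [MeasurableSpace X] (C : ℝ) (f : X → ℝ)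
    (D : Measure (X × ℝ)) : ℝ :=
  ∫ z, marginLoss C (z.2 * f z.1) ∂D

end

/-! The bound is a Rademacher-complexity estimate whose complexity term is controlled through fourth
moments. For signs `v` and sample points `x i` put `Y k = ∑ i, v i * expVal (ρ (x i)) (A k)`.
Cauchy–Schwarz in the coefficients `α` bounds the square of `∑ i, v i * f (x i)` by `2 ^ n * ∑ w k *
Y k ^ 2`, and Cauchy–Schwarz in the weights (`∑ w k ^ 2 = 1`) bounds its fourth power by `(2 ^ n) ^
2 * ∑ k ∈ I, Y k ^ 4`, in which neither `w` nor `α` survives (`sum_mul_gtqkFun_pow_four_le`).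
Khinchine's inequality and Jensen then give the complexity bound `(3 p) ^ (1/4) * |R| * √N` for the
unnormalized sums, at every sample; since `3 ≤ (23/11) ^ 2`, the constant `η₀ = 23/22` suffices.

Contraction (`signAvg_contraction`) passes from `f` to its margin loss at the cost of `1/C`,
symmetrization (`integral_iSup_le_integral_signAvg`) costs a factor `2`, and McDiarmid's inequality
turns the bound in mean into one with high probability. Because the complexity bound holds at every
sample, one application of McDiarmid is enough. Suprema are taken over finite subfamilies only; a
dense sequence of parameters and continuity recover the whole class. -/

/-! ### Rademacher averages and their fourth moments. -/

/-- The average of `F σ` over independent uniform signs `σ ∈ {-1, 1}ᴺ`. -/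
noncomputable def signAvg : (N : ℕ) → ((Fin N → ℝ) → ℝ) → ℝ
  | 0, F => F Fin.elim0
  | N + 1, F => (signAvg N (fun v => F (Fin.cons 1 v)) +
      signAvg N (fun v => F (Fin.cons (-1) v))) / 2

theorem signAvg_mono {N : ℕ} {F G : (Fin N → ℝ) → ℝ} (h : ∀ v, F v ≤ G v) :
    signAvg N F ≤ signAvg N G := by
  induction N with
  | zero => exact h _
  | succ N ih =>
    have h₁ := ih (F := fun v => F (Fin.cons 1 v)) (G := fun v => G (Fin.cons 1 v)) fun v => h _
    have h₂ := ih (F := fun v => F (Fin.cons (-1) v)) (G := fun v => G (Fin.cons (-1) v))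
      fun v => h _
    simp only [signAvg]
    linarith

theorem signAvg_add {N : ℕ} (F G : (Fin N → ℝ) → ℝ) :
    signAvg N (fun v => F v + G v) = signAvg N F + signAvg N G := by
  induction N with
  | zero => rfl
  | succ N ih =>
    simp only [signAvg, ih]
    ring

theorem signAvg_const_mul {N : ℕ} (c : ℝ) (F : (Fin N → ℝ) → ℝ) :
    signAvg N (fun v => c * F v) = c * signAvg N F := by
  induction N with
  | zero => rfl
  | succ N ih =>
    simp only [signAvg, ih]
    ring

theorem signAvg_zero {N : ℕ} : signAvg N (fun _ => 0) = 0 := by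
  simpa using signAvg_const_mul (N := N) 0 (fun _ => 0)

theorem signAvg_sum {N : ℕ} {ι : Type*} (s : Finset ι) (F : ι → (Fin N → ℝ) → ℝ) :
    signAvg N (fun v => ∑ k ∈ s, F k v) = ∑ k ∈ s, signAvg N (F k) := by
  classical
  induction s using Finset.induction_on with
  | empty => simpa using signAvg_zero
  | insert a s ha ih => simp only [Finset.sum_insert ha, signAvg_add, ih]

/-- Jensen's inequality for `t ^ 4`; the two-point case is convexity of the square, used twice. -/
theorem signAvg_pow_four_le {N : ℕ} (F : (Fin N → ℝ) → ℝ) :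
    signAvg N F ^ 4 ≤ signAvg N (fun v => F v ^ 4) := by
  induction N with
  | zero => exact le_rfl
  | succ N ih =>
    have h₁ := ih (fun v => F (Fin.cons 1 v))
    have h₂ := ih (fun v => F (Fin.cons (-1) v))
    simp only [signAvg]
    set a := signAvg N (fun v => F (Fin.cons 1 v))
    set b := signAvg N (fun v => F (Fin.cons (-1) v))
    have h : ((a + b) / 2) ^ 4 ≤ (a ^ 4 + b ^ 4) / 2 := by
      have e₁ : ((a + b) / 2) ^ 2 ≤ (a ^ 2 + b ^ 2) / 2 := by nlinarith [sq_nonneg (a - b)]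
      have e₂ : ((a + b) / 2) ^ 4 ≤ ((a ^ 2 + b ^ 2) / 2) ^ 2 := by
        calc ((a + b) / 2) ^ 4 = (((a + b) / 2) ^ 2) ^ 2 := by ring
          _ ≤ _ := pow_le_pow_left₀ (sq_nonneg _) e₁ 2
      nlinarith [sq_nonneg (a ^ 2 - b ^ 2)]
    linarith

/-- Khinchine's fourth-moment inequality, for a shifted Rademacher sum. -/
theorem signAvg_add_sum_pow_four_le {N : ℕ} (s : ℝ) (a : Fin N → ℝ) :
    signAvg N (fun v => (s + ∑ i, v i * a i) ^ 4) ≤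
      s ^ 4 + 6 * s ^ 2 * ∑ i, a i ^ 2 + 3 * (∑ i, a i ^ 2) ^ 2 := by
  induction N generalizing s with
  | zero => simp [signAvg]
  | succ N ih =>
    -- The shift `s` absorbs the first sign, and odd powers of `a 0` cancel on averaging the two
    -- cases.
    have h₁ := ih (s + a 0) (fun i => a i.succ)
    have h₂ := ih (s - a 0) (fun i => a i.succ)
    simp only [signAvg, Fin.sum_univ_succ, Fin.cons_zero, Fin.cons_succ]
    simp only [one_mul, neg_one_mul, ← add_assoc, ← sub_eq_add_neg]
    set V := ∑ i : Fin N, a i.succ ^ 2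
    -- The claimed bound exceeds the averaged one by exactly `2 * a 0 ^ 4`.
    nlinarith [sq_nonneg (a 0 ^ 2)]

/-! ### Finite suprema and the contraction principle. -/

theorem le_iSup_of_finite {T : Type*} [Finite T] (g : T → ℝ) (t : T) : g t ≤ ⨆ t, g t :=
  le_ciSup (Set.finite_range g).bddAbove t

theorem abs_iSup_le {T : Type*} [Finite T] [Nonempty T] {g : T → ℝ} {M : ℝ}
    (h : ∀ t, |g t| ≤ M) : |⨆ t, g t| ≤ M := by
  obtain ⟨t⟩ := ‹Nonempty T›
  rw [abs_le]
  exact ⟨(neg_le_of_abs_le (h t)).trans (le_iSup_of_finite g t),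
    ciSup_le fun t => (le_abs_self _).trans (h t)⟩

theorem abs_iSup_sub_iSup_le {T : Type*} [Finite T] [Nonempty T] {g h : T → ℝ} {c : ℝ}
    (H : ∀ t, |g t - h t| ≤ c) : |(⨆ t, g t) - ⨆ t, h t| ≤ c := by
  rw [abs_le]
  constructor
  · have : (⨆ t, h t) ≤ (⨆ t, g t) + c := ciSup_le fun t => by
      linarith [le_iSup_of_finite g t, (abs_le.1 (H t)).1]
    linarith
  · have : (⨆ t, g t) ≤ (⨆ t, h t) + c := ciSup_le fun t => by
      linarith [le_iSup_of_finite h t, (abs_le.1 (H t)).2]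
    linarith

/-- One sign of the contraction principle. The left side is a supremum over pairs `(s, t)` of `A s +
A t + (b s - b t)`, and `b s - b t ≤ |a s - a t|`; whichever sign the absolute value takes,
exchanging `s` and `t` if necessary gives a pair admitted on the right. -/
theorem iSup_add_add_iSup_sub_le {T : Type*} [Finite T] [Nonempty T] (A a b : T → ℝ)
    (h : ∀ s t, |b s - b t| ≤ |a s - a t|) :
    (⨆ t, (A t + b t)) + (⨆ t, (A t - b t)) ≤ (⨆ t, (A t + a t)) + ⨆ t, (A t - a t) := by
  have key : ∀ s t, (A s + b s) + (A t - b t) ≤ (⨆ t, (A t + a t)) + ⨆ t, (A t - a t) := by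
    intro s t
    have h₁ := le_iSup_of_finite (fun t => A t + a t) s
    have h₂ := le_iSup_of_finite (fun t => A t - a t) t
    have h₃ := le_iSup_of_finite (fun t => A t + a t) t
    have h₄ := le_iSup_of_finite (fun t => A t - a t) s
    have h₅ := (le_abs_self _).trans (h s t)
    rcases abs_cases (a s - a t) with ⟨e, _⟩ | ⟨e, _⟩ <;> rw [e] at h₅ <;> linarith
  have h₁ : (⨆ t, (A t + b t)) ≤
      (⨆ t, (A t + a t)) + (⨆ t, (A t - a t)) - ⨆ t, (A t - b t) := by
    refine ciSup_le fun s => ?_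
    have : (⨆ t, (A t - b t)) ≤
        (⨆ t, (A t + a t)) + (⨆ t, (A t - a t)) - (A s + b s) :=
      ciSup_le fun t => by linarith [key s t]
    linarith
  linarith

/-- The Ledoux–Talagrand contraction principle for Rademacher averages over a finite set. -/
theorem signAvg_contraction {T : Type*} [Finite T] [Nonempty T] {N : ℕ} (A : T → ℝ)
    (a b : Fin N → T → ℝ) (h : ∀ i s t, |b i s - b i t| ≤ |a i s - a i t|) :
    signAvg N (fun v => ⨆ t, (A t + ∑ i, v i * b i t)) ≤
      signAvg N (fun v => ⨆ t, (A t + ∑ i, v i * a i t)) := by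
  induction N generalizing A with
  | zero => simp [signAvg]
  | succ N ih =>
    -- With `± b 0` moved into the offset, induction replaces the other `b i`; `h₃` then replaces `b
    -- 0` for each fixed choice of the remaining signs.
    have h₁ := ih (fun t => A t + b 0 t) (fun i => a i.succ) (fun i => b i.succ)
      fun i => h i.succ
    have h₂ := ih (fun t => A t - b 0 t) (fun i => a i.succ) (fun i => b i.succ)
      fun i => h i.succ
    have h₃ : signAvg N (fun v => (⨆ t, (A t + b 0 t + ∑ i : Fin N, v i * a i.succ t)) +
          ⨆ t, (A t - b 0 t + ∑ i : Fin N, v i * a i.succ t)) ≤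
        signAvg N (fun v => (⨆ t, (A t + a 0 t + ∑ i : Fin N, v i * a i.succ t)) +
          ⨆ t, (A t - a 0 t + ∑ i : Fin N, v i * a i.succ t)) := by
      refine signAvg_mono fun v => ?_
      have := iSup_add_add_iSup_sub_le (fun t => A t + ∑ i : Fin N, v i * a i.succ t)
        (a 0) (b 0) (h 0)
      simpa only [add_right_comm, add_sub_right_comm] using this
    rw [signAvg_add, signAvg_add] at h₃
    simp only [signAvg, Fin.sum_univ_succ, Fin.cons_zero, Fin.cons_succ]
    simp only [one_mul, neg_one_mul, ← add_assoc, ← sub_eq_add_neg]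
    linarith

/-! ### Closure properties of bounded measurable functions. -/

/-- Bounded measurable real functions. -/
def IsBddMeasurable {Z : Type*} [MeasurableSpace Z] (F : Z → ℝ) : Prop :=
  Measurable F ∧ ∃ M, ∀ z, |F z| ≤ M

theorem IsBddMeasurable.integrable {Z : Type*} [MeasurableSpace Z] {F : Z → ℝ}
    (h : IsBddMeasurable F) (μ : Measure Z) [IsFiniteMeasure μ] : Integrable F μ := by
  obtain ⟨M, hM⟩ := h.2
  exact .of_bound h.1.aestronglyMeasurable M (.of_forall hM)

theorem IsBddMeasurable.comp {Y Z : Type*} [MeasurableSpace Y] [MeasurableSpace Z] {F : Z → ℝ}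
    (h : IsBddMeasurable F) {g : Y → Z} (hg : Measurable g) : IsBddMeasurable (fun y => F (g y)) :=
  ⟨h.1.comp hg, h.2.imp fun _ hM y => hM (g y)⟩

theorem IsBddMeasurable.const {Z : Type*} [MeasurableSpace Z] (c : ℝ) :
    IsBddMeasurable (fun _ : Z => c) :=
  ⟨measurable_const, |c|, fun _ => le_rfl⟩

theorem IsBddMeasurable.add {Z : Type*} [MeasurableSpace Z] {F G : Z → ℝ}
    (hF : IsBddMeasurable F) (hG : IsBddMeasurable G) : IsBddMeasurable (fun z => F z + G z) := by
  obtain ⟨M, hM⟩ := hF.2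
  obtain ⟨M', hM'⟩ := hG.2
  exact ⟨hF.1.add hG.1, M + M', fun z => (abs_add_le _ _).trans (add_le_add (hM z) (hM' z))⟩

theorem IsBddMeasurable.const_mul {Z : Type*} [MeasurableSpace Z] {F : Z → ℝ}
    (hF : IsBddMeasurable F) (c : ℝ) : IsBddMeasurable (fun z => c * F z) := by
  obtain ⟨M, hM⟩ := hF.2
  refine ⟨hF.1.const_mul c, |c| * M, fun z => ?_⟩
  rw [abs_mul]
  exact mul_le_mul_of_nonneg_left (hM z) (abs_nonneg c)

theorem IsBddMeasurable.sub {Z : Type*} [MeasurableSpace Z] {F G : Z → ℝ}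
    (hF : IsBddMeasurable F) (hG : IsBddMeasurable G) : IsBddMeasurable (fun z => F z - G z) := by
  simpa only [neg_one_mul, ← sub_eq_add_neg] using hF.add (hG.const_mul (-1))

theorem IsBddMeasurable.sum {Z ι : Type*} [MeasurableSpace Z] {F : ι → Z → ℝ} (s : Finset ι)
    (hF : ∀ i, IsBddMeasurable (F i)) : IsBddMeasurable (fun z => ∑ i ∈ s, F i z) := by
  classical
  induction s using Finset.induction_on with
  | empty => simpa using IsBddMeasurable.const 0
  | insert a s ha ih => simpa only [Finset.sum_insert ha] using (hF a).add ih

theorem IsBddMeasurable.exp {Z : Type*} [MeasurableSpace Z] {F : Z → ℝ}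
    (hF : IsBddMeasurable F) : IsBddMeasurable (fun z => Real.exp (F z)) := by
  obtain ⟨M, hM⟩ := hF.2
  refine ⟨hF.1.exp, Real.exp M, fun z => ?_⟩
  rw [Real.abs_exp]
  exact Real.exp_le_exp.2 ((le_abs_self _).trans (hM z))

theorem IsBddMeasurable.iSup {Z T : Type*} [MeasurableSpace Z] [Finite T] [Nonempty T]
    {F : T → Z → ℝ} (hF : ∀ t, IsBddMeasurable (F t)) : IsBddMeasurable (fun z => ⨆ t, F t z) := by
  choose M hM using fun t => (hF t).2
  exact ⟨Measurable.iSup fun t => (hF t).1, ⨆ t, M t,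
    fun z => abs_iSup_le fun t => (hM t z).trans (le_iSup_of_finite M t)⟩

theorem IsBddMeasurable.signAvg {Z : Type*} [MeasurableSpace Z] {N : ℕ}
    {F : (Fin N → ℝ) → Z → ℝ} (hF : ∀ v, IsBddMeasurable (F v)) :
    IsBddMeasurable (fun z => signAvg N (fun v => F v z)) := by
  induction N with
  | zero => exact hF _
  | succ N ih =>
    have h₁ := ih (F := fun v => F (Fin.cons 1 v)) fun v => hF _
    have h₂ := ih (F := fun v => F (Fin.cons (-1) v)) fun v => hF _
    simpa only [_root_.signAvg, div_eq_inv_mul] using (h₁.add h₂).const_mul 2⁻¹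

theorem IsBddMeasurable.integral_prod_right {Y Z : Type*} [MeasurableSpace Y] [MeasurableSpace Z]
    {F : Y → Z → ℝ} (hF : IsBddMeasurable (fun q : Y × Z => F q.1 q.2)) (μ : Measure Z)
    [IsProbabilityMeasure μ] : IsBddMeasurable (fun y => ∫ z, F y z ∂μ) := by
  obtain ⟨M, hM⟩ := hF.2
  refine ⟨(hF.1.stronglyMeasurable.integral_prod_right (ν := μ)).measurable, M, fun y => ?_⟩
  have := norm_integral_le_of_norm_le_const (μ := μ) (f := F y) (C := M)
    (.of_forall fun z => hM (y, z))
  simpa using this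

/-! ### Concentration and symmetrization on product spaces. -/

section Product

variable {Z : Type*} [MeasurableSpace Z]

theorem measurable_fin_cons {N : ℕ} :
    Measurable (fun q : Z × (Fin N → Z) => (Fin.cons q.1 q.2 : Fin (N + 1) → Z)) := by
  refine measurable_pi_lambda _ fun i => ?_
  refine Fin.cases ?_ (fun i => ?_) i
  · simpa using measurable_fst
  · simpa [Function.comp_def] using (measurable_pi_apply i).comp measurable_snd

theorem measurePreserving_fin_cons (D : Measure Z) [IsProbabilityMeasure D] (N : ℕ) :
    MeasurePreserving (fun q : Z × (Fin N → Z) => (Fin.cons q.1 q.2 : Fin (N + 1) → Z))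
      (D.prod (Measure.pi fun _ => D)) (Measure.pi fun _ => D) := by
  have h := (measurePreserving_piFinSuccAbove (fun _ : Fin (N + 1) => D) 0).symm
  convert h using 1
  ext q i
  simp [MeasurableEquiv.piFinSuccAbove]

theorem integral_pi_fin_succ (D : Measure Z) [IsProbabilityMeasure D] {N : ℕ}
    {F : (Fin (N + 1) → Z) → ℝ} (hF : IsBddMeasurable F) :
    ∫ S, F S ∂Measure.pi (fun _ => D) =
      ∫ z, ∫ S, F (Fin.cons z S) ∂Measure.pi (fun _ => D) ∂D := by
  have h := measurePreserving_fin_cons D N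
  rw [← h.map_eq, integral_map h.measurable.aemeasurable hF.1.aestronglyMeasurable,
    integral_prod _ ((hF.comp measurable_fin_cons).integrable _)]

theorem integral_pi_fin_succ' (D : Measure Z) [IsProbabilityMeasure D] {N : ℕ}
    {F : (Fin (N + 1) → Z) → ℝ} (hF : IsBddMeasurable F) :
    ∫ S, F S ∂Measure.pi (fun _ => D) =
      ∫ S, ∫ z, F (Fin.cons z S) ∂D ∂Measure.pi (fun _ => D) := by
  rw [integral_pi_fin_succ D hF]
  exact integral_integral_swap ((hF.comp measurable_fin_cons).integrable _)

/-- Hoeffding's lemma for functions of oscillation at most `1`. -/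
theorem integral_exp_sub_integral_le (D : Measure Z) [IsProbabilityMeasure D] {g : Z → ℝ}
    (hg : IsBddMeasurable g) (hosc : ∀ z z', |g z - g z'| ≤ 1) (l : ℝ) :
    ∫ z, Real.exp (l * (g z - ∫ z, g z ∂D)) ∂D ≤ Real.exp (l ^ 2 / 8) := by
  obtain ⟨M, hM⟩ := hg.2
  obtain ⟨z₀⟩ := nonempty_of_isProbabilityMeasure D
  have hbb : BddBelow (Set.range g) :=
    ⟨-M, by rintro _ ⟨z, rfl⟩; exact neg_le_of_abs_le (hM z)⟩
  have : Nonempty Z := ⟨z₀⟩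
  have hb : ∀ᵐ z ∂D, g z ∈ Set.Icc (⨅ z, g z) ((⨅ z, g z) + 1) := .of_forall fun z => by
    refine ⟨ciInf_le hbb z, ?_⟩
    have : g z - 1 ≤ ⨅ z, g z := le_ciInf fun z' => by linarith [(abs_le.1 (hosc z z')).2]
    linarith
  have h := (ProbabilityTheory.hasSubgaussianMGF_of_mem_Icc hg.1.aemeasurable hb).mgf_le l
  refine h.trans_eq ?_
  congr 1
  simp
  ring

/-- The exponential-moment form of McDiarmid's bounded difference inequality. -/
theorem integral_exp_sub_integral_le_of_boundedDifferences (D : Measure Z)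
    [IsProbabilityMeasure D] {N : ℕ} {F : (Fin N → Z) → ℝ} (hF : IsBddMeasurable F)
    (hd : ∀ S i z, |F (Function.update S i z) - F S| ≤ 1) (l : ℝ) :
    ∫ S, Real.exp (l * (F S - ∫ S, F S ∂Measure.pi (fun _ => D))) ∂Measure.pi (fun _ => D) ≤
      Real.exp (N * (l ^ 2 / 8)) := by
  induction N with
  | zero =>
    have : ∀ S, F S = F Fin.elim0 := fun S => congrArg F (Subsingleton.elim _ _)
    simp [this]
  | succ N ih =>
    have hFz : ∀ z, IsBddMeasurable fun S : Fin N → Z => F (Fin.cons z S) := fun z =>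
      hF.comp (measurable_fin_cons.comp measurable_prodMk_left)
    have hg : IsBddMeasurable fun z => ∫ S : Fin N → Z, F (Fin.cons z S) ∂Measure.pi fun _ => D :=
      (hF.comp measurable_fin_cons).integral_prod_right _
    -- Split `F - 𝔼 F` as `(F - g z) + (g z - 𝔼 g)`: for fixed `z` the first part falls to
    -- induction, and the second to Hoeffding's lemma, since averaging keeps the oscillation at most
    -- `1`.
    set g : Z → ℝ := fun z => ∫ S : Fin N → Z, F (Fin.cons z S) ∂Measure.pi fun _ => D with hgdef
    have hosc : ∀ z z', |g z - g z'| ≤ 1 := by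
      intro z z'
      rw [hgdef]
      simp only
      rw [← integral_sub ((hFz z).integrable _) ((hFz z').integrable _)]
      have := norm_integral_le_of_norm_le_const (μ := Measure.pi fun _ : Fin N => D)
        (f := fun S => F (Fin.cons z S) - F (Fin.cons z' S)) (C := 1)
        (.of_forall fun S => by
          simpa [Fin.update_cons_zero] using hd (Fin.cons z' S) 0 z)
      simpa using this
    have hE : ∫ S, F S ∂Measure.pi (fun _ => D) = ∫ z, g z ∂D := integral_pi_fin_succ D hF
    have hexp : IsBddMeasurable fun S => Real.exp (l * (F S - ∫ z, g z ∂D)) :=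
      ((hF.sub (.const _)).const_mul l).exp
    rw [hE, integral_pi_fin_succ D hexp]
    have step : ∀ z, ∫ S : Fin N → Z, Real.exp (l * (F (Fin.cons z S) - ∫ z, g z ∂D))
          ∂Measure.pi (fun _ => D) ≤
        Real.exp (N * (l ^ 2 / 8)) * Real.exp (l * (g z - ∫ z, g z ∂D)) := by
      intro z
      have h := ih (hFz z) fun S i y => by
        simpa [Fin.cons_update] using hd (Fin.cons z S) i.succ y
      have e : ∀ S : Fin N → Z, Real.exp (l * (F (Fin.cons z S) - ∫ z, g z ∂D)) =
          Real.exp (l * (F (Fin.cons z S) - g z)) * Real.exp (l * (g z - ∫ z, g z ∂D)) := by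
        intro S
        rw [← Real.exp_add]
        congr 1
        ring
      simp_rw [e]
      rw [integral_mul_const]
      exact mul_le_mul_of_nonneg_right h (Real.exp_nonneg _)
    calc _ ≤ ∫ z, Real.exp (N * (l ^ 2 / 8)) * Real.exp (l * (g z - ∫ z, g z ∂D)) ∂D :=
          integral_mono (((hexp.comp measurable_fin_cons).integral_prod_right _).integrable _)
            ((((hg.sub (.const _)).const_mul l).exp.const_mul _).integrable _) step
      _ ≤ Real.exp (N * (l ^ 2 / 8)) * Real.exp (l ^ 2 / 8) := by
          rw [integral_const_mul]
          exact mul_le_mul_of_nonneg_left (integral_exp_sub_integral_le D hg hosc l)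
            (Real.exp_nonneg _)
      _ = _ := by
          rw [← Real.exp_add]
          congr 1
          push_cast
          ring

/-- McDiarmid's bounded difference inequality. -/
theorem measureReal_ge_le_of_boundedDifferences (D : Measure Z)
    [IsProbabilityMeasure D] {N : ℕ} {F : (Fin N → Z) → ℝ} (hF : IsBddMeasurable F)
    (hd : ∀ S i z, |F (Function.update S i z) - F S| ≤ 1) {s : ℝ} (hs : 0 ≤ s) :
    (Measure.pi fun _ => D).real {S | s ≤ F S - ∫ S, F S ∂Measure.pi (fun _ => D)} ≤
      Real.exp (-(2 * s ^ 2 / N)) := by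
  -- The variance proxy is `N / 4` because `N * (l ^ 2 / 8) = (N / 4) * l ^ 2 / 2`.
  have h : ProbabilityTheory.HasSubgaussianMGF
      (fun S => F S - ∫ S, F S ∂Measure.pi (fun _ => D)) ((N : NNReal) / 4)
      (Measure.pi fun _ => D) := by
    refine ⟨fun t => ((hF.sub (.const _)).const_mul t).exp.integrable _, fun t => ?_⟩
    refine (integral_exp_sub_integral_le_of_boundedDifferences D hF hd t).trans_eq ?_
    congr 1
    simp
    ring
  refine (h.measure_ge_le hs).trans_eq ?_
  congr 1
  simp
  rcases eq_or_ne (N : ℝ) 0 with h0 | h0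
  · simp [h0]
  · field_simp
    ring

/-- Symmetrization: the expected supremum of the centred empirical process is at most twice the
expected Rademacher complexity. -/
theorem integral_iSup_le_integral_signAvg (D : Measure Z) [IsProbabilityMeasure D]
    {T : Type*} [Finite T] [Nonempty T] {N : ℕ} {f : T → Z → ℝ} (hf : ∀ t, IsBddMeasurable (f t))
    (A : T → ℝ) :
    ∫ S : Fin N → Z, ⨆ t, (A t + ∑ i, ((∫ z, f t z ∂D) - f t (S i))) ∂Measure.pi (fun _ => D) ≤
      ∫ S : Fin N → Z, signAvg N (fun v => ⨆ t, (A t + ∑ i, v i * (2 * f t (S i))))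
        ∂Measure.pi (fun _ => D) := by
  induction N generalizing A with
  | zero => simp [signAvg]
  | succ N ih =>
    -- Symmetrization of a single coordinate, without a ghost sample: `B + 𝔼 f - f z` is the mean of
    -- `B + 2 * 𝔼 f` and `B - 2 * f z`, and the first is at most the expected supremum of `B + 2 *
    -- f`.
    have hone : ∀ B : T → ℝ, ∫ z, ⨆ t, (B t + ((∫ z, f t z ∂D) - f t z)) ∂D ≤
        ((∫ z, ⨆ t, (B t + 2 * f t z) ∂D) + ∫ z, ⨆ t, (B t - 2 * f t z) ∂D) / 2 := by
      intro B
      have hp : IsBddMeasurable fun z => ⨆ t, (B t + 2 * f t z) :=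
        .iSup fun t => (IsBddMeasurable.const _).add ((hf t).const_mul 2)
      have hm : IsBddMeasurable fun z => ⨆ t, (B t - 2 * f t z) :=
        .iSup fun t => (IsBddMeasurable.const _).sub ((hf t).const_mul 2)
      have hl : IsBddMeasurable fun z => ⨆ t, (B t + ((∫ z, f t z ∂D) - f t z)) :=
        .iSup fun t => (IsBddMeasurable.const _).add ((IsBddMeasurable.const _).sub (hf t))
      have hpt : ∀ z, ⨆ t, (B t + ((∫ z, f t z ∂D) - f t z)) ≤
          ((∫ z, ⨆ t, (B t + 2 * f t z) ∂D) + ⨆ t, (B t - 2 * f t z)) / 2 := by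
        intro z
        refine ciSup_le fun t => ?_
        have h₁ : B t + 2 * ∫ z, f t z ∂D ≤ ∫ z, ⨆ t, (B t + 2 * f t z) ∂D := by
          have : ∫ z, (B t + 2 * f t z) ∂D = B t + 2 * ∫ z, f t z ∂D := by
            rw [integral_add (integrable_const _) (((hf t).const_mul 2).integrable _),
              integral_const_mul]
            simp
          rw [← this]
          exact integral_mono
            (((IsBddMeasurable.const _).add ((hf t).const_mul 2)).integrable _)
            (hp.integrable _) fun z => le_iSup_of_finite (fun t => B t + 2 * f t z) t
        have h₂ := le_iSup_of_finite (fun t => B t - 2 * f t z) t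
        linarith
      calc _ ≤ ∫ z, ((∫ z, ⨆ t, (B t + 2 * f t z) ∂D) + ⨆ t, (B t - 2 * f t z)) / 2 ∂D :=
            integral_mono (hl.integrable _)
              (((IsBddMeasurable.const _).add hm).integrable D |>.div_const 2) hpt
        _ = _ := by
            rw [integral_div, integral_add (integrable_const _) (hm.integrable _)]
            simp
    have hfi : ∀ (M : ℕ) t (i : Fin M), IsBddMeasurable fun S : Fin M → Z => f t (S i) :=
      fun M t i => (hf t).comp (measurable_pi_apply i)
    have hL : ∀ (M : ℕ) (B : T → ℝ), IsBddMeasurable fun S : Fin M → Z =>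
        ⨆ t, (B t + ∑ i, ((∫ z, f t z ∂D) - f t (S i))) := fun M B =>
      .iSup fun t => (IsBddMeasurable.const _).add
        (.sum _ fun i => (IsBddMeasurable.const _).sub (hfi M t i))
    have hR : ∀ (M : ℕ) (B : T → ℝ), IsBddMeasurable fun S : Fin M → Z =>
        signAvg M (fun v => ⨆ t, (B t + ∑ i, v i * (2 * f t (S i)))) := fun M B =>
      .signAvg fun v => .iSup fun t => (IsBddMeasurable.const _).add
        (.sum _ fun i => ((hfi M t i).const_mul 2).const_mul (v i))
    have hz : ∀ c : ℝ, IsBddMeasurable fun q : Z × (Fin N → Z) =>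
        ⨆ t, (A t + c * f t q.1 + ∑ i, ((∫ z, f t z ∂D) - f t (q.2 i))) := fun c =>
      .iSup fun t => ((IsBddMeasurable.const _).add
        (((hf t).comp measurable_fst).const_mul c)).add
        (.sum _ fun i => (IsBddMeasurable.const _).sub ((hfi N t i).comp measurable_snd))
    have hz' : ∀ c : ℝ, IsBddMeasurable fun q : Z × (Fin N → Z) =>
        signAvg N (fun v => ⨆ t, (A t + c * f t q.1 + ∑ i, v i * (2 * f t (q.2 i)))) := fun c =>
      .signAvg fun v => .iSup fun t => ((IsBddMeasurable.const _).add
        (((hf t).comp measurable_fst).const_mul c)).add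
        (.sum _ fun i => (((hfi N t i).comp measurable_snd).const_mul 2).const_mul (v i))
    have key : ∀ c : ℝ, ∫ S : Fin N → Z, ∫ z, ⨆ t, (A t + c * f t z +
          ∑ i, ((∫ z, f t z ∂D) - f t (S i))) ∂D ∂Measure.pi (fun _ => D) ≤
        ∫ z, ∫ S : Fin N → Z, signAvg N (fun v => ⨆ t, (A t + c * f t z +
          ∑ i, v i * (2 * f t (S i)))) ∂Measure.pi (fun _ => D) ∂D := by
      intro c
      rw [← integral_integral_swap ((hz c).integrable _)]
      exact integral_mono (((hz c).integral_prod_right _).integrable _)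
        (((hz' c).integral_prod_right _).integrable _) fun z => ih (fun t => A t + c * f t z)
    have hzi : ∀ c : ℝ, IsBddMeasurable fun S : Fin N → Z => ∫ z, ⨆ t, (A t + c * f t z +
          ∑ i, ((∫ z, f t z ∂D) - f t (S i))) ∂D := fun c =>
      ((hz c).comp measurable_swap).integral_prod_right D
    -- On the left the new coordinate is integrated innermost, so that `hone` applies with the rest
    -- of the sample frozen. `key` then swaps the integrals and uses induction with `± 2 * f t z` in
    -- the offset.
    rw [integral_pi_fin_succ' D (hL _ A), integral_pi_fin_succ D (hR _ A)]
    simp only [Fin.sum_univ_succ, Fin.cons_zero, Fin.cons_succ]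
    calc _ ≤ ∫ S : Fin N → Z, ((∫ z, ⨆ t, (A t + 2 * f t z +
              ∑ i, ((∫ z, f t z ∂D) - f t (S i))) ∂D) +
            ∫ z, ⨆ t, (A t + (-2) * f t z +
              ∑ i, ((∫ z, f t z ∂D) - f t (S i))) ∂D) / 2 ∂Measure.pi (fun _ => D) := by
          refine integral_mono ?_ ((((hzi 2).add (hzi (-2))).integrable _).div_const 2) fun S => ?_
          · have := ((hL (N + 1) A).comp measurable_fin_cons).comp
              (measurable_swap (α := Fin N → Z) (β := Z))
            simp only [Fin.sum_univ_succ, Fin.cons_zero, Fin.cons_succ] at this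
            exact (this.integral_prod_right D).integrable _
          · have := hone fun t => A t + ∑ i, ((∫ z, f t z ∂D) - f t (S i))
            simpa only [sub_eq_add_neg, neg_mul, add_assoc, add_comm, add_left_comm] using this
      _ ≤ ((∫ z, ∫ S : Fin N → Z, signAvg N (fun v => ⨆ t, (A t + 2 * f t z +
              ∑ i, v i * (2 * f t (S i)))) ∂Measure.pi (fun _ => D) ∂D) +
            ∫ z, ∫ S : Fin N → Z, signAvg N (fun v => ⨆ t, (A t + (-2) * f t z +
              ∑ i, v i * (2 * f t (S i)))) ∂Measure.pi (fun _ => D) ∂D) / 2 := by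
          rw [integral_div, integral_add ((hzi 2).integrable _) ((hzi (-2)).integrable _)]
          have h₁ := key 2
          have h₂ := key (-2)
          linarith
      _ = _ := by
          rw [← integral_add (((hz' 2).integral_prod_right _).integrable _)
            (((hz' (-2)).integral_prod_right _).integrable _), ← integral_div]
          refine integral_congr_ae (.of_forall fun z => ?_)
          have hc : ∀ c : ℝ, IsBddMeasurable fun S : Fin N → Z => signAvg N (fun v =>
              ⨆ t, (A t + c * f t z + ∑ i, v i * (2 * f t (S i)))) := fun c =>
            (hz' c).comp measurable_prodMk_left
          simp only
          rw [← integral_add ((hc 2).integrable _) ((hc (-2)).integrable _), ← integral_div]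
          refine integral_congr_ae (.of_forall fun S => ?_)
          simp only [signAvg, Fin.cons_zero, Fin.cons_succ, one_mul, neg_mul,
            ← add_assoc]

end Product

/-! ### Uniform deviation bounds, from finite to separable classes. -/

section UniformDeviation

variable {Z : Type*} [MeasurableSpace Z]

theorem signAvg_iSup_mul_left {T : Type*} {N : ℕ} {c : ℝ} (hc : 0 ≤ c) (a : Fin N → T → ℝ) :
    signAvg N (fun v => ⨆ t, ∑ i, v i * (c * a i t)) =
      c * signAvg N (fun v => ⨆ t, ∑ i, v i * a i t) := by
  rw [← signAvg_const_mul]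
  simp only [Real.mul_iSup_of_nonneg hc, Finset.mul_sum, mul_left_comm]

theorem isBddMeasurable_of_mem_Icc {f : Z → ℝ} (hm : Measurable f)
    (h01 : ∀ z, f z ∈ Set.Icc (0 : ℝ) 1) : IsBddMeasurable f :=
  ⟨hm, 1, fun z => by rw [abs_of_nonneg (h01 z).1]; exact (h01 z).2⟩

/-- A one-sided uniform deviation bound for a finite class of `[0, 1]`-valued functions, in terms
of a bound `B` on its (unnormalized) empirical Rademacher complexity. -/
theorem measure_exists_deviation_le (D : Measure Z) [IsProbabilityMeasure D] {T : Type*} [Finite T]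
    [Nonempty T] {N : ℕ} {f : T → Z → ℝ} (hm : ∀ t, Measurable (f t))
    (h01 : ∀ t z, f t z ∈ Set.Icc (0 : ℝ) 1) {B : ℝ}
    (hB : ∀ S : Fin N → Z, signAvg N (fun v => ⨆ t, ∑ i, v i * f t (S i)) ≤ B)
    {s : ℝ} (hs : 0 ≤ s) :
    Measure.pi (fun _ : Fin N => D)
        {S | ∃ t, 2 * B + s < ∑ i, ((∫ z, f t z ∂D) - f t (S i))} ≤
      ENNReal.ofReal (Real.exp (-(2 * s ^ 2 / N))) := by
  have hf : ∀ t, IsBddMeasurable (f t) := fun t => isBddMeasurable_of_mem_Icc (hm t) (h01 t)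
  set G : (Fin N → Z) → ℝ := fun S => ⨆ t, ∑ i, ((∫ z, f t z ∂D) - f t (S i)) with hG
  have hfi : ∀ t (i : Fin N), IsBddMeasurable fun S : Fin N → Z => f t (S i) :=
    fun t i => (hf t).comp (measurable_pi_apply i)
  have hGm : IsBddMeasurable G :=
    .iSup fun t => .sum _ fun i => (IsBddMeasurable.const _).sub (hfi t i)
  have hd : ∀ S i z, |G (Function.update S i z) - G S| ≤ 1 := by
    intro S i z
    refine abs_iSup_sub_iSup_le fun t => ?_
    rw [← Finset.sum_sub_distrib, Finset.sum_eq_single i]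
    · have h₁ := h01 t z
      have h₂ := h01 t (S i)
      simp only [Function.update_self]
      rw [abs_le]
      constructor <;> linarith [h₁.1, h₁.2, h₂.1, h₂.2]
    · intro j _ hj
      simp [Function.update_of_ne hj]
    · simp
  -- Since `B` bounds the sign average at every sample, it bounds its expectation.
  have hE : ∫ S, G S ∂Measure.pi (fun _ => D) ≤ 2 * B := by
    have h := integral_iSup_le_integral_signAvg (N := N) D hf (fun _ => 0)
    simp only [zero_add] at h
    refine h.trans ?_
    have hb : ∀ S : Fin N → Z,
        signAvg N (fun v => ⨆ t, ∑ i, v i * (2 * f t (S i))) ≤ 2 * B := fun S => by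
      rw [signAvg_iSup_mul_left zero_le_two (fun i t => f t (S i))]
      exact mul_le_mul_of_nonneg_left (hB S) zero_le_two
    have hR : IsBddMeasurable fun S : Fin N → Z =>
        signAvg N (fun v => ⨆ t, ∑ i, v i * (2 * f t (S i))) :=
      .signAvg fun v => .iSup fun t => .sum _ fun i => ((hfi t i).const_mul 2).const_mul (v i)
    refine (integral_mono (hR.integrable _) (integrable_const (2 * B)) hb).trans_eq ?_
    simp
  calc _ ≤ Measure.pi (fun _ : Fin N => D) {S | s ≤ G S - ∫ S, G S ∂Measure.pi (fun _ => D)} := by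
        refine measure_mono ?_
        rintro S ⟨t, ht⟩
        have := le_iSup_of_finite (fun t => ∑ i, ((∫ z, f t z ∂D) - f t (S i))) t
        simp only [Set.mem_ofPred_eq, hG] at hE ⊢
        linarith
    _ ≤ _ := by
        rw [← ofReal_measureReal]
        exact ENNReal.ofReal_le_ofReal (measureReal_ge_le_of_boundedDifferences D hGm hd hs)

/-- A one-sided uniform deviation bound for a separably parametrized class of `[0, 1]`-valued
functions, in terms of a bound `B` on the (unnormalized) empirical Rademacher complexity of its
finite subfamilies. -/
theorem exists_measurableSet_uniform_deviation_le (D : Measure Z) [IsProbabilityMeasure D]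
    {Θ : Type*} [TopologicalSpace Θ] [SecondCountableTopology Θ] {N : ℕ} {f : Θ → Z → ℝ}
    (hm : ∀ θ, Measurable (f θ)) (h01 : ∀ θ z, f θ z ∈ Set.Icc (0 : ℝ) 1)
    (hcont : ∀ z, Continuous fun θ => f θ z) {B : ℝ}
    (hB : ∀ (S : Fin N → Z) (m : ℕ) (θ : Fin (m + 1) → Θ),
      signAvg N (fun v => ⨆ t, ∑ i, v i * f (θ t) (S i)) ≤ B)
    {s : ℝ} (hs : 0 ≤ s) :
    ∃ E : Set (Fin N → Z), MeasurableSet E ∧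
      ENNReal.ofReal (1 - Real.exp (-(2 * s ^ 2 / N))) ≤ Measure.pi (fun _ => D) E ∧
      ∀ S ∈ E, ∀ θ, ∑ i, ((∫ z, f θ z ∂D) - f θ (S i)) ≤ 2 * B + s := by
  rcases isEmpty_or_nonempty Θ with hΘ | hΘ
  · refine ⟨Set.univ, .univ, ?_, fun S _ θ => hΘ.elim θ⟩
    rw [measure_univ]
    exact ENNReal.ofReal_le_one.2 (by linarith [Real.exp_pos (-(2 * s ^ 2 / N))])
  set u := TopologicalSpace.denseSeq Θ
  -- These events increase with `m` and obey a bound independent of `m`, so continuity from below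
  -- bounds their union with no union-bound loss.
  set bad : ℕ → Set (Fin N → Z) := fun m =>
    {S | ∃ t : Fin (m + 1), 2 * B + s < ∑ i, ((∫ z, f (u t) z ∂D) - f (u t) (S i))} with hbad
  have hmeas : ∀ k, Measurable fun S : Fin N → Z => ∑ i, ((∫ z, f (u k) z ∂D) - f (u k) (S i)) :=
    fun k => Finset.measurable_sum _ fun i _ =>
      measurable_const.sub ((hm _).comp (measurable_pi_apply i))
  have hbm : ∀ m, MeasurableSet (bad m) := fun m => by
    simp only [hbad, Set.ofPred_exists]
    exact .iUnion fun t => measurableSet_lt measurable_const (hmeas t)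
  have hmono : Monotone bad := by
    rintro m m' h S ⟨t, ht⟩
    exact ⟨⟨t, by omega⟩, ht⟩
  have hle : Measure.pi (fun _ : Fin N => D) (⋃ m, bad m) ≤
      ENNReal.ofReal (Real.exp (-(2 * s ^ 2 / N))) := by
    rw [hmono.measure_iUnion]
    exact iSup_le fun m => measure_exists_deviation_le D (fun t => hm _) (fun t => h01 _)
      (fun S => hB S m fun t => u t) hs
  refine ⟨(⋃ m, bad m)ᶜ, (MeasurableSet.iUnion hbm).compl, ?_, fun S hS => ?_⟩
  · rw [prob_compl_eq_one_sub (.iUnion hbm), ENNReal.ofReal_sub _ (Real.exp_nonneg _),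
      ENNReal.ofReal_one]
    exact tsub_le_tsub_left hle 1
  -- The deviation is continuous in `θ`, by dominated convergence for the integral, so the
  -- inequality defines a closed set and extends from the dense sequence to all `θ`.
  · have hc : Continuous fun θ => ∑ i, ((∫ z, f θ z ∂D) - f θ (S i)) := by
      refine continuous_finsetSum _ fun i _ => Continuous.sub ?_ (hcont _)
      refine continuous_of_dominated (bound := fun _ => 1)
        (fun θ => (hm θ).aestronglyMeasurable) (fun θ => .of_forall fun z => ?_)
        (integrable_const _) (.of_forall hcont)
      rw [Real.norm_eq_abs, abs_of_nonneg (h01 θ z).1]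
      exact (h01 θ z).2
    have hcl : IsClosed {θ | ∑ i, ((∫ z, f θ z ∂D) - f θ (S i)) ≤ 2 * B + s} :=
      isClosed_le hc continuous_const
    have hsub : Set.range u ⊆ {θ | ∑ i, ((∫ z, f θ z ∂D) - f θ (S i)) ≤ 2 * B + s} := by
      rintro _ ⟨m, rfl⟩
      by_contra h
      exact hS (Set.mem_iUnion.2 ⟨m, ⟨m, by omega⟩, not_le.1 h⟩)
    intro θ
    exact hcl.closure_subset_iff.2 hsub (TopologicalSpace.denseRange_denseSeq Θ θ)

end UniformDeviation

/-! ### The margin loss. -/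

/-- As a clamp of `1 - z / C` to `[0, 1]`, the loss is visibly continuous, `[0, 1]`-valued and
`1/C`-Lipschitz. -/
theorem marginLoss_eq_max_min {C : ℝ} (hC : 0 < C) (z : ℝ) :
    marginLoss C z = max 0 (min 1 (1 - z / C)) := by
  unfold marginLoss
  split_ifs with h₁ h₂
  · have : z / C ≤ 0 := div_nonpos_of_nonpos_of_nonneg h₁ hC.le
    rw [min_eq_left (by linarith), max_eq_right zero_le_one]
  · have h₃ : 0 ≤ z / C := div_nonneg (not_le.1 h₁).le hC.le
    have h₄ : z / C ≤ 1 := (div_le_one hC).2 h₂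
    rw [min_eq_right (by linarith), max_eq_right (by linarith)]
  · have h₄ : 1 ≤ z / C := (one_le_div hC).2 (not_le.1 h₂).le
    rw [min_eq_right (by linarith), max_eq_left (by linarith)]

theorem continuous_marginLoss {C : ℝ} (hC : 0 < C) : Continuous (marginLoss C) := by
  rw [funext (marginLoss_eq_max_min hC)]
  fun_prop

theorem marginLoss_mem_Icc {C : ℝ} (hC : 0 < C) (z : ℝ) :
    marginLoss C z ∈ Set.Icc (0 : ℝ) 1 := by
  rw [marginLoss_eq_max_min hC]
  exact ⟨le_max_left _ _, max_le zero_le_one (min_le_left _ _)⟩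

theorem abs_marginLoss_sub_le {C : ℝ} (hC : 0 < C) (u v : ℝ) :
    |marginLoss C u - marginLoss C v| ≤ |u / C - v / C| := by
  rw [marginLoss_eq_max_min hC, marginLoss_eq_max_min hC]
  generalize u / C = a
  generalize v / C = b
  grind

/-! ### Rademacher complexity of the GTQK class. -/

theorem measurable_expVal {X : Type*} [MeasurableSpace X] {n : ℕ} {ρ : X → QubitOp n}
    (hρ : ∀ a b, Measurable fun x => ρ x a b) (A : QubitOp n) :
    Measurable fun x => expVal (ρ x) A := by
  unfold expVal
  simp only [Matrix.trace, Matrix.diag_apply, Matrix.mul_apply]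
  exact Complex.measurable_re.comp (Finset.measurable_sum _ fun a _ =>
    Finset.measurable_sum _ fun b _ => (hρ a b).mul_const _)

/-- The element of the GTQK hypothesis class with weights `w` and coefficients `α`. -/
noncomputable def gtqkFun {X : Type*} {n : ℕ} (ρ : X → QubitOp n) (A : Fin (4 ^ n) → QubitOp n)
    (w α : Fin (4 ^ n) → ℝ) (x : X) : ℝ :=
  ∑ k, α k * Real.sqrt (2 ^ n * w k) * expVal (ρ x) (A k)

/-- Cauchy–Schwarz against `α` (`h₁`) and then against `w` (`h₂`). The right side depends on
neither, so it bounds the supremum over the class for each choice of signs; its sum over `I` is the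
source of `p ^ (1/4)`. -/
theorem sum_mul_gtqkFun_pow_four_le {X : Type*} {n N : ℕ} (ρ : X → QubitOp n)
    (A : Fin (4 ^ n) → QubitOp n) {I : Finset (Fin (4 ^ n))} {w α : Fin (4 ^ n) → ℝ}
    (hw : IsGTQKWeight I w) (hα : ∑ k, α k ^ 2 ≤ 1) (v : Fin N → ℝ) (x : Fin N → X) :
    (∑ i, v i * gtqkFun ρ A w α (x i)) ^ 4 ≤
      (2 ^ n) ^ 2 * ∑ k ∈ I, (∑ i, v i * expVal (ρ (x i)) (A k)) ^ 4 := by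
  set Y : Fin (4 ^ n) → ℝ := fun k => ∑ i, v i * expVal (ρ (x i)) (A k) with hY
  have hw0 : ∀ k, 0 ≤ w k := fun k => by
    by_cases hk : k ∈ I
    · exact (hw.1 k hk).le
    · exact (hw.2.1 k hk).ge
  have e : ∑ i, v i * gtqkFun ρ A w α (x i) = ∑ k, α k * (Real.sqrt (2 ^ n * w k) * Y k) := by
    simp only [gtqkFun, hY, Finset.mul_sum]
    rw [Finset.sum_comm]
    exact Finset.sum_congr rfl fun k _ => Finset.sum_congr rfl fun i _ => by ring
  have h₁ : (∑ i, v i * gtqkFun ρ A w α (x i)) ^ 2 ≤ 2 ^ n * ∑ k ∈ I, w k * Y k ^ 2 := by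
    rw [e]
    refine (Finset.sum_mul_sq_le_sq_mul_sq _ _ _).trans ?_
    have hnn : 0 ≤ ∑ k, (Real.sqrt (2 ^ n * w k) * Y k) ^ 2 :=
      Finset.sum_nonneg fun k _ => sq_nonneg _
    refine (mul_le_of_le_one_left hnn hα).trans_eq ?_
    rw [Finset.mul_sum, ← Finset.sum_subset (Finset.subset_univ I)]
    · refine Finset.sum_congr rfl fun k _ => ?_
      rw [mul_pow, Real.sq_sqrt (mul_nonneg (by positivity) (hw0 k)), mul_assoc]
    · intro k _ hk
      simp [hw.2.1 k hk]
  have h₂ : (∑ k ∈ I, w k * Y k ^ 2) ^ 2 ≤ ∑ k ∈ I, Y k ^ 4 := by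
    refine (Finset.sum_mul_sq_le_sq_mul_sq _ _ _).trans ?_
    have h1 : ∑ k ∈ I, w k ^ 2 ≤ 1 := by
      rw [← hw.2.2]
      exact Finset.sum_le_sum_of_subset_of_nonneg (Finset.subset_univ I) fun k _ _ => sq_nonneg _
    refine (mul_le_of_le_one_left (Finset.sum_nonneg fun k _ => sq_nonneg _) h1).trans_eq ?_
    exact Finset.sum_congr rfl fun k _ => by ring
  calc (∑ i, v i * gtqkFun ρ A w α (x i)) ^ 4
      = ((∑ i, v i * gtqkFun ρ A w α (x i)) ^ 2) ^ 2 := by ring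
    _ ≤ (2 ^ n * ∑ k ∈ I, w k * Y k ^ 2) ^ 2 := pow_le_pow_left₀ (sq_nonneg _) h₁ 2
    _ = (2 ^ n) ^ 2 * (∑ k ∈ I, w k * Y k ^ 2) ^ 2 := by ring
    _ ≤ _ := mul_le_mul_of_nonneg_left h₂ (by positivity)

/-- The empirical Rademacher complexity of the GTQK hypothesis class. -/
theorem signAvg_iSup_gtqkFun_pow_four_le {X : Type*} {n N : ℕ} {ρ : X → QubitOp n}
    {A : Fin (4 ^ n) → QubitOp n} {I : Finset (Fin (4 ^ n))} {R : ℝ}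
    (hR : ∀ k ∈ I, ∀ x, 2 ^ n * legoKernel ρ (A k) x x ≤ R ^ 2)
    {T : Type*} [Finite T] [Nonempty T] {w α : T → Fin (4 ^ n) → ℝ}
    (hw : ∀ t, IsGTQKWeight I (w t)) (hα : ∀ t, ∑ k, α t k ^ 2 ≤ 1) (x : Fin N → X) :
    ∃ b, signAvg N (fun v => ⨆ t, ∑ i, v i * gtqkFun ρ A (w t) (α t) (x i)) ≤ b ∧
      b ^ 4 ≤ 3 * I.card * (N * R ^ 2) ^ 2 := by
  set Q : (Fin N → ℝ) → ℝ := fun v =>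
    (2 ^ n) ^ 2 * ∑ k ∈ I, (∑ i, v i * expVal (ρ (x i)) (A k)) ^ 4 with hQ
  have hQ0 : ∀ v, 0 ≤ Q v := fun v => by positivity
  -- The witness is the sign average of the fourth root of `Q`; Jensen bounds its fourth power by
  -- the average of `Q`, to which Khinchine applies termwise.
  refine ⟨signAvg N fun v => Real.sqrt (Real.sqrt (Q v)), signAvg_mono fun v => ?_, ?_⟩
  · refine ciSup_le fun t => (le_abs_self _).trans (Real.abs_le_sqrt ?_)
    refine (le_abs_self _).trans (Real.abs_le_sqrt ?_)
    rw [← pow_mul]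
    exact sum_mul_gtqkFun_pow_four_le ρ A (hw t) (hα t) v x
  · refine (signAvg_pow_four_le _).trans ?_
    have e : ∀ v, Real.sqrt (Real.sqrt (Q v)) ^ 4 = Q v := fun v => by
      rw [show 4 = 2 * 2 from rfl, pow_mul, Real.sq_sqrt (Real.sqrt_nonneg _),
        Real.sq_sqrt (hQ0 v)]
    rw [funext e, hQ, signAvg_const_mul, signAvg_sum, Finset.mul_sum]
    have hk : ∀ k ∈ I, (2 ^ n) ^ 2 *
        signAvg N (fun v => (∑ i, v i * expVal (ρ (x i)) (A k)) ^ 4) ≤ 3 * (N * R ^ 2) ^ 2 := by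
      intro k hk
      have h := signAvg_add_sum_pow_four_le 0 fun i => expVal (ρ (x i)) (A k)
      simp only [zero_add] at h
      have hs : 2 ^ n * ∑ i, expVal (ρ (x i)) (A k) ^ 2 ≤ N * R ^ 2 := by
        rw [Finset.mul_sum]
        refine (Finset.sum_le_card_nsmul _ _ (R ^ 2) fun i _ => ?_).trans_eq (by simp)
        have := hR k hk (x i)
        rwa [legoKernel, ← sq] at this
      calc _ ≤ (2 ^ n) ^ 2 * (3 * (∑ i, expVal (ρ (x i)) (A k) ^ 2) ^ 2) := by
            refine mul_le_mul_of_nonneg_left (h.trans_eq ?_) (by positivity)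
            ring
        _ = 3 * (2 ^ n * ∑ i, expVal (ρ (x i)) (A k) ^ 2) ^ 2 := by ring
        _ ≤ _ := by
            refine mul_le_mul_of_nonneg_left (pow_le_pow_left₀ ?_ hs 2) (by norm_num)
            positivity
    refine (Finset.sum_le_card_nsmul _ _ _ hk).trans_eq ?_
    rw [nsmul_eq_mul]
    ring

/-! ### Assembly of the margin bound. -/

/-- The margin bound for the GTQK hypothesis class under labels that are rounded to `{-1, 1}`. -/
theorem exists_measurableSet_gtqkFun_deviation_le {X : Type*} [MeasurableSpace X] {n N p : ℕ}
    {C R δ : ℝ} (hC : 0 < C) (hδ0 : 0 < δ) (hδ1 : δ ≤ 1) (hN : 0 < N) {ρ : X → QubitOp n}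
    (hρ : ∀ a b, Measurable fun x => ρ x a b) (A : Fin (4 ^ n) → QubitOp n)
    {I : Finset (Fin (4 ^ n))} (hI : I.card = p)
    (hR : ∀ k ∈ I, ∀ x, 2 ^ n * legoKernel ρ (A k) x x ≤ R ^ 2)
    (D : Measure (X × ℝ)) [IsProbabilityMeasure D] {σ : ℝ → ℝ} (hσm : Measurable σ)
    (hσ : ∀ y, |σ y| = 1) :
    ∃ E : Set (Fin N → X × ℝ), MeasurableSet E ∧
      ENNReal.ofReal (1 - δ) ≤ Measure.pi (fun _ => D) E ∧
      ∀ S ∈ E, ∀ w α : Fin (4 ^ n) → ℝ, IsGTQKWeight I w → ∑ k, α k ^ 2 ≤ 1 →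
        ∑ i, ((∫ z, marginLoss C (σ z.2 * gtqkFun ρ A w α z.1) ∂D) -
            marginLoss C (σ (S i).2 * gtqkFun ρ A w α (S i).1)) ≤
          N * (2 * (p : ℝ) ^ (1 / 4 : ℝ) / C * Real.sqrt (2 * (23 / 22) * R ^ 2 / N) +
            Real.sqrt (Real.log (1 / δ) / (2 * N))) := by
  have hN' : (0 : ℝ) < N := Nat.cast_pos.2 hN
  let Θ := {θ : (Fin (4 ^ n) → ℝ) × (Fin (4 ^ n) → ℝ) //
    IsGTQKWeight I θ.1 ∧ ∑ k, θ.2 k ^ 2 ≤ 1}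
  set f : Θ → X × ℝ → ℝ := fun θ z =>
    marginLoss C (σ z.2 * gtqkFun ρ A θ.1.1 θ.1.2 z.1) with hf
  have hm : ∀ θ, Measurable (f θ) := fun θ => by
    refine (continuous_marginLoss hC).measurable.comp ((hσm.comp measurable_snd).mul ?_)
    exact Finset.measurable_sum _ fun k _ =>
      ((measurable_expVal hρ (A k)).comp measurable_fst).const_mul _
  have h01 : ∀ θ z, f θ z ∈ Set.Icc (0 : ℝ) 1 := fun θ z => marginLoss_mem_Icc hC _
  have hcont : ∀ z, Continuous fun θ => f θ z := fun z => by
    refine (continuous_marginLoss hC).comp (continuous_const.mul ?_)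
    unfold gtqkFun
    fun_prop
  -- Chosen so that McDiarmid's failure probability `exp (-(2 * s ^ 2 / N))` equals `δ`.
  set s := N * Real.sqrt (Real.log (1 / δ) / (2 * N)) with hs
  set b := N * ((p : ℝ) ^ (1 / 4 : ℝ) * Real.sqrt (2 * (23 / 22) * R ^ 2 / N)) with hb
  have hb4 : b ^ 4 = (23 / 11) ^ 2 * p * (N * R ^ 2) ^ 2 := by
    have e₁ : ((p : ℝ) ^ (1 / 4 : ℝ)) ^ 4 = p := by
      rw [← Real.rpow_natCast, ← Real.rpow_mul (Nat.cast_nonneg p)]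
      norm_num
    have e₂ : Real.sqrt (2 * (23 / 22) * R ^ 2 / N) ^ 4 = (2 * (23 / 22) * R ^ 2 / N) ^ 2 := by
      rw [show 4 = 2 * 2 from rfl, pow_mul, Real.sq_sqrt (by positivity)]
    rw [hb, mul_pow, mul_pow, e₁, e₂]
    field_simp
    ring
  have hlog : 0 ≤ Real.log (1 / δ) := Real.log_nonneg ((one_le_div hδ0).2 hδ1)
  have hexp : Real.exp (-(2 * s ^ 2 / N)) = δ := by
    rw [hs, mul_pow, Real.sq_sqrt (by positivity)]
    have : 2 * ((N : ℝ) ^ 2 * (Real.log (1 / δ) / (2 * N))) / N = Real.log (1 / δ) := by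
      field_simp
    rw [this, one_div, Real.log_inv, neg_neg, Real.exp_log hδ0]
  have hB : ∀ (S : Fin N → X × ℝ) (m : ℕ) (θ : Fin (m + 1) → Θ),
      signAvg N (fun v => ⨆ t, ∑ i, v i * f (θ t) (S i)) ≤ C⁻¹ * b := by
    intro S m θ
    obtain ⟨b', hb', hb'4⟩ := signAvg_iSup_gtqkFun_pow_four_le hR (fun t => (θ t).2.1)
      (fun t => (θ t).2.2) fun i => (S i).1
    -- Comparison of fourth powers, using `3 ≤ (23/11) ^ 2`.
    have hbb : b' ≤ b := by
      by_contra! h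
      have h4 : b ^ 4 < b' ^ 4 := pow_lt_pow_left₀ h (by positivity) (by norm_num)
      rw [hI] at hb'4
      have hnn : 0 ≤ (p : ℝ) * (N * R ^ 2) ^ 2 := by positivity
      nlinarith
    -- As `|σ y| = 1`, multiplying by the label does not change distances, so the loss is
    -- `1/C`-Lipschitz in the value of the hypothesis.
    have hc := signAvg_contraction (fun _ => 0)
      (fun i t => C⁻¹ * gtqkFun ρ A (θ t).1.1 (θ t).1.2 (S i).1) (fun i t => f (θ t) (S i))
      fun i t t' => by
        refine (abs_marginLoss_sub_le hC _ _).trans_eq ?_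
        rw [mul_div_assoc, mul_div_assoc, ← mul_sub, abs_mul, hσ, one_mul, div_eq_inv_mul,
          div_eq_inv_mul]
    simp only [zero_add] at hc
    rw [signAvg_iSup_mul_left (inv_nonneg.2 hC.le)
      (fun i t => gtqkFun ρ A (θ t).1.1 (θ t).1.2 (S i).1)] at hc
    exact hc.trans (mul_le_mul_of_nonneg_left (hb'.trans hbb) (inv_nonneg.2 hC.le))
  obtain ⟨E, hEm, hEp, hE⟩ :=
    exists_measurableSet_uniform_deviation_le D hm h01 hcont hB (s := s) (by positivity)
  refine ⟨E, hEm, by rwa [hexp] at hEp, fun S hS w α hw hα => ?_⟩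
  refine (hE S hS ⟨(w, α), hw, hα⟩).trans_eq ?_
  rw [hs, hb]
  ring

theorem mainTheorem2 (C : ℝ) (hC : 0 < C) (R : ℝ) (δ : ℝ) (hδ0 : 0 < δ) (hδ1 : δ ≤ 1) :
    ∃ K : ℝ, ∀ (n : ℕ) (X : Type u) [MeasurableSpace X]
      (U : X → Matrix.unitaryGroup (Fin n → Fin 2) ℂ) (ρ₀ : QubitOp n)
      (A : Fin (4 ^ n) → QubitOp n) (p : ℕ) (I : Finset (Fin (4 ^ n)))
      (D : Measure (X × ℝ)) [IsProbabilityMeasure D] (N : ℕ),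
      IsDensityOp ρ₀ →
      (∀ a b, Measurable fun x => encodedState U ρ₀ x a b) →
      IsOrthonormalHermitianBasis A →
      I.card = p →
      (∀ i ∈ I, ∀ x, 2 ^ n * legoKernel (encodedState U ρ₀) (A i) x x ≤ R ^ 2) →
      (∀ᵐ z ∂D, z.2 = 1 ∨ z.2 = -1) →
      0 < N →
      ∃ E : Set (Fin N → X × ℝ), MeasurableSet E ∧
        ENNReal.ofReal (1 - δ) ≤ Measure.pi (fun _ : Fin N => D) E ∧
        ∀ S ∈ E, ∀ f ∈ gtqkClass (encodedState U ρ₀) A I,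
          trueMarginLoss C f D ≤ empiricalMarginLoss C f S
              + 2 * (p : ℝ) ^ (1 / 4 : ℝ) / C * Real.sqrt (2 * (23 / 22) * R ^ 2 / N)
              + 3 * Real.sqrt (Real.log (2 / δ) / (2 * N)) ∧
          trueMarginLoss C f D - empiricalMarginLoss C f S
            ≤ K * (p : ℝ) ^ (1 / 4 : ℝ) / Real.sqrt N := by
  -- The sum of the two error coefficients once `1 / √N` is factored out; the confidence term also
  -- fits because `1 ≤ p ^ (1/4)`.
  refine ⟨2 / C * Real.sqrt (2 * (23 / 22) * R ^ 2) + 3 * Real.sqrt (Real.log (2 / δ) / 2), ?_⟩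
  intro n X _ U ρ₀ A p I D _ N _ hρ _ hI hR hy hN
  have hN' : (0 : ℝ) < N := Nat.cast_pos.2 hN
  -- Labels are `± 1` only almost surely. Rounding makes this hold everywhere, and it changes
  -- nothing on the full-measure event `L` or in the true loss.
  set σ : ℝ → ℝ := fun y => if y = 1 then 1 else -1 with hσ
  have hσm : Measurable σ :=
    Measurable.ite (measurableSet_singleton 1) measurable_const measurable_const
  have hσ1 : ∀ y, |σ y| = 1 := fun y => by
    simp only [hσ]
    split_ifs <;> simp
  have hσy : ∀ y, y = 1 ∨ y = -1 → σ y = y := by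
    rintro y (rfl | rfl)
    · simp [hσ]
    · simp only [hσ]
      norm_num
  obtain ⟨E, hEm, hEp, hE⟩ := exists_measurableSet_gtqkFun_deviation_le (N := N) hC hδ0 hδ1 hN hρ A
    hI hR D hσm hσ1
  set L : Set (Fin N → X × ℝ) := {S | ∀ i, (S i).2 = 1 ∨ (S i).2 = -1} with hL
  have hLm : MeasurableSet L := by
    simp only [hL, Set.ofPred_forall]
    refine .iInter fun i => ?_
    have : Measurable fun S : Fin N → X × ℝ => (S i).2 :=
      measurable_snd.comp (measurable_pi_apply i)
    exact (this (measurableSet_singleton 1)).union (this (measurableSet_singleton (-1)))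
  have hLae : ∀ᵐ S ∂Measure.pi (fun _ : Fin N => D), S ∈ L :=
    ae_all_iff.2 fun i =>
      (measurePreserving_eval (fun _ : Fin N => D) i).quasiMeasurePreserving.ae hy
  refine ⟨E ∩ L, hEm.inter hLm, ?_, ?_⟩
  · rwa [Set.inter_comm, Measure.measure_inter_eq_of_ae hLae]
  rintro S ⟨hSE, hSL⟩ f ⟨w, α, hw, hα, rfl⟩
  change trueMarginLoss C (gtqkFun _ A w α) D ≤ empiricalMarginLoss C (gtqkFun _ A w α) S + _ + _ ∧
    trueMarginLoss C (gtqkFun _ A w α) D - empiricalMarginLoss C (gtqkFun _ A w α) S ≤ _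
  have h := hE S hSE w α hw hα
  have hT : ∫ z, marginLoss C (σ z.2 * gtqkFun (encodedState U ρ₀) A w α z.1) ∂D =
      trueMarginLoss C (gtqkFun (encodedState U ρ₀) A w α) D :=
    integral_congr_ae (hy.mono fun z hz => by simp only [hσy _ hz])
  have hS : ∀ i, σ (S i).2 = (S i).2 := fun i => hσy _ (hSL i)
  have hsum : ∑ i, marginLoss C ((S i).2 * gtqkFun (encodedState U ρ₀) A w α (S i).1) =
      N * empiricalMarginLoss C (gtqkFun (encodedState U ρ₀) A w α) S := by
    unfold empiricalMarginLoss
    field_simp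
  rw [hT, Finset.sum_sub_distrib] at h
  simp only [hS, hsum] at h
  rw [Finset.sum_const, Finset.card_univ, Fintype.card_fin, nsmul_eq_mul, ← mul_sub] at h
  have h' := le_of_mul_le_mul_left h hN'
  have hlog : Real.sqrt (Real.log (1 / δ) / (2 * N)) ≤
      3 * Real.sqrt (Real.log (2 / δ) / (2 * N)) := by
    have h₁ : Real.sqrt (Real.log (1 / δ) / (2 * N)) ≤ Real.sqrt (Real.log (2 / δ) / (2 * N)) := by
      gcongr
      norm_num
    linarith [Real.sqrt_nonneg (Real.log (2 / δ) / (2 * N))]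
  -- A hypothesis `f` comes with weights whose squares sum to `1`, so `I` cannot be empty.
  have hp : (1 : ℝ) ≤ (p : ℝ) ^ (1 / 4 : ℝ) := by
    refine Real.one_le_rpow ?_ (by norm_num)
    have : p ≠ 0 := by
      rintro rfl
      have hw2 := hw.2.2
      simp [hw.2.1 _ (Finset.card_eq_zero.1 hI ▸ Finset.notMem_empty _)] at hw2
    exact_mod_cast Nat.one_le_iff_ne_zero.2 this
  refine ⟨by linarith, ?_⟩
  calc _ ≤ 2 * (p : ℝ) ^ (1 / 4 : ℝ) / C * Real.sqrt (2 * (23 / 22) * R ^ 2 / N) +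
        3 * Real.sqrt (Real.log (2 / δ) / (2 * N)) := by linarith
    _ = 2 / C * Real.sqrt (2 * (23 / 22) * R ^ 2) * (p : ℝ) ^ (1 / 4 : ℝ) / Real.sqrt N +
        3 * Real.sqrt (Real.log (2 / δ) / 2) * 1 / Real.sqrt N := by
      rw [← div_div, Real.sqrt_div' _ hN'.le, Real.sqrt_div' _ hN'.le]
      ring
    _ ≤ 2 / C * Real.sqrt (2 * (23 / 22) * R ^ 2) * (p : ℝ) ^ (1 / 4 : ℝ) / Real.sqrt N +
        3 * Real.sqrt (Real.log (2 / δ) / 2) * (p : ℝ) ^ (1 / 4 : ℝ) / Real.sqrt N := by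
      gcongr
    _ = _ := by ring
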